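/- Let $S \subseteq \mathbb{N}$, let $d \in \mathbb{N}$, and let $\{G_n : n \in S\}$ be a family of $d$-regular expander graphs, where $G_n = (V_n,E_n)$ is a simple graph with $n$ vertices: there is a constant $c>0$ such that for every $n \in S$ and every $A \subseteq V_n$ with $|A| \le n/2$, at least $c|A|$ edges of $G_n$ join $A$ to $V_n \setminus A$. The Tseitin formula $\mathrm{TS}_n$ has one Boolean variable $x_e$ (with a twin variable $\bar x_e$) for each $e \in E_n$ and consists of the equations $$\prod_{e \in E_n :\, u \in e} (1-2x_e) = -1 \qquad (u \in V_n),$$ which say that $\sum_{e \ni u} x_e$ is odd for every $u \in V_n$. An SOS refutation of $\mathrm{TS}_n$ is a formal identity $$-1 = \sum_{i=1}^{k} r_i^2 + \sum_{u \in V_n} t_u \Bigl(1+\prod_{e \ni u}(1-2x_e)\Bigr) + \sum_{e \in E_n} \bigl( a_e (x_e^2 - x_e) + b_e (\bar x_e^2 - \bar x_e) + c_e (x_e + \bar x_e - 1) \bigr)$$ with $k \in \mathbb{N}$ and arbitrary polynomials $r_i, t_u, a_e, b_e, c_e$ with real coefficients in the variables $x_e, \bar x_e$ ($e \in E_n$);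 its monomial size is $\sum_{i} \mathrm{size}(r_i) + \sum_{u} \mathrm{size}(t_u)$, where $\mathrm{size}(p)$ is the number of terms of $p$. Then there exist a real $\epsilon > 0$ and $N \in \mathbb{N}$ such that for every $n \in S$ with $n \ge N$, every SOS refutation of $\mathrm{TS}_n$ has monomial size at least $2^{\epsilon n}$. -/

import Mathlib

/-- Real polynomials in the pairs of twin variables `x i`, `x̄ i` with `i : σ`.
The basic variable `x i` is `X (Sum.inl i)`, its twin `x̄ i` is `X (Sum.inr i)`. -/
abbrev TwinPoly (σ : Type*) : Type _ := MvPolynomial (σ ⊕ σ) ℝ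

namespace TwinPoly

/-- The basic variable `x i`. -/
noncomputable def basic {σ : Type*} (i : σ) : TwinPoly σ := MvPolynomial.X (Sum.inl i)

/-- The twin variable `x̄ i`. -/
noncomputable def twin {σ : Type*} (i : σ) : TwinPoly σ := MvPolynomial.X (Sum.inr i)

/-- Monomial size: the number of terms, i.e. of monomials with a non-zero coefficient. -/
noncomputable def size {σ : Type*} (p : TwinPoly σ) : ℕ := p.support.card

/-- The sum of the squares of the members of a finite sequence of polynomials. -/
noncomputable def sumSq {σ : Type*} (r : List (TwinPoly σ)) : TwinPoly σ :=
  (r.map (fun f => f ^ 2)).sum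

/-- The total number of explicit monomials in a finite sequence of polynomials. -/
noncomputable def listSize {σ : Type*} (r : List (TwinPoly σ)) : ℕ := (r.map size).sum

end TwinPoly

/-- A Sums-of-Squares proof of `g ≥ 0` from the inequality constraints `q j ≥ 0` and the
equality constraints `p j = 0`, for Boolean variables in twin pairs: a formal identity
`g = s₀ + ∑ s j * q j + ∑ t j * p j + (combination of the Boolean axioms)`,
where `s₀` and each `s j` are explicitly given sums of squares. The Boolean axioms are
`x i ^ 2 - x i`, `x̄ i ^ 2 - x̄ i` and `x i + x̄ i - 1`, with multipliers
`uBasic i`, `uTwin i`, `uSum i`. -/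
structure SOSProof {σ ι κ : Type*} [Fintype σ] [Fintype ι] [Fintype κ]
    (q : ι → TwinPoly σ) (p : κ → TwinPoly σ) (g : TwinPoly σ) where
  r₀ : List (TwinPoly σ)
  r : ι → List (TwinPoly σ)
  t : κ → TwinPoly σ
  uBasic : σ → TwinPoly σ
  uTwin : σ → TwinPoly σ
  uSum : σ → TwinPoly σ
  identity : g = TwinPoly.sumSq r₀ + ∑ j, TwinPoly.sumSq (r j) * q j + ∑ j, t j * p j
    + ((∑ i, uBasic i * (TwinPoly.basic i ^ 2 - TwinPoly.basic i))
      + (∑ i, uTwin i * (TwinPoly.twin i ^ 2 - TwinPoly.twin i))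
      + (∑ i, uSum i * (TwinPoly.basic i + TwinPoly.twin i - 1)))

/-- The monomial size of an SOS proof: the number of monomials of the polynomials that are
squared and of the multipliers of the equality constraints. The multipliers of the Boolean
axioms are not counted. -/
noncomputable def SOSProof.monomialSize {σ ι κ : Type*} [Fintype σ] [Fintype ι] [Fintype κ]
    {q : ι → TwinPoly σ} {p : κ → TwinPoly σ} {g : TwinPoly σ} (P : SOSProof q p g) : ℕ :=
  TwinPoly.listSize P.r₀ + ∑ j, TwinPoly.listSize (P.r j) + ∑ j, TwinPoly.size (P.t j)

/-- An SOS refutation is an SOS proof of `-1 ≥ 0`. -/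
abbrev SOSRefutation {σ ι κ : Type*} [Fintype σ] [Fintype ι] [Fintype κ]
    (q : ι → TwinPoly σ) (p : κ → TwinPoly σ) : Type _ :=
  SOSProof q p (-1)

section Tseitin

variable {V : Type*} [Fintype V] [DecidableEq V] (G : SimpleGraph V) [DecidableRel G.Adj]

/-- The equality constraint of the Tseitin formula at the vertex `u`, in the form
`∏_{e ∋ u} (1 - 2 x_e) + 1 = 0`: an odd number of the edges at `u` have value `1`.
There is one Boolean variable for each edge of `G`. -/
noncomputable def tseitinPoly (u : V) : TwinPoly G.edgeSet :=
  (∏ e ∈ Finset.univ.filter (fun e : G.edgeSet => u ∈ (e : Sym2 V)), (1 - 2 * TwinPoly.basic e)) + 1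

/-- SOS refutations of the Tseitin formula of `G`: it consists of one equality constraint for
each vertex and has no inequality constraints. -/
abbrev TseitinRefutation : Type _ :=
  SOSRefutation (fun j : Empty => (j.elim : TwinPoly G.edgeSet)) (tseitinPoly G)

/-- Every vertex set `A` with at most half of the vertices has at least `c * |A|` edges between
`A` and its complement. -/
def HasEdgeExpansion (c : ℝ) : Prop :=
  ∀ A : Finset V, 2 * A.card ≤ Fintype.card V → c * A.card ≤ (G.interedges A Aᶜ).card

end Tseitin

/-- The graphs `G n` with `n ∈ S` form a family of `d`-regular expander graphs, where `G n` has
`n` vertices: they are `d`-regular, and their edge expansion is bounded away from zero. -/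
def IsRegularExpanderFamily (S : Set ℕ) (G : (n : ℕ) → SimpleGraph (Fin n))
    [∀ n, DecidableRel (G n).Adj] (d : ℕ) : Prop :=
  (∀ n ∈ S, (G n).IsRegularOfDegree d) ∧ ∃ c : ℝ, 0 < c ∧ ∀ n ∈ S, HasEdgeExpansion (G n) c

/-! Substituting characters `χ_e = 1 - 2 x_e` makes the Boolean axioms vanish and turns each
constraint into the statement that a product of characters is a sign. Multiplying the constraints
over a vertex set `A` fixes the sign of the character of the edge boundary of `A`.

Low width. Let the functional send the boundary character of every small `A` to the sign that it
must have, and all other characters to 0. In an expander a set of size at most `n/2` with a short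
boundary is much smaller than `n/2`, so small sets are closed under symmetric difference as long as
the boundary stays short. On characters of weight at most `k` the functional then has a signed
equivalence relation as its matrix, which is positive semidefinite, and it annihilates low-weight
multiples of the constraints. Applied to a refutation it yields `-1 ≥ 0`
(`no_low_width_refutation`).

Reduction to low width. If `n` is odd, `d` is even. While wide monomials survive, some literal
occurs in a fixed proportion of them; setting it to zero `q` times, with `q` linear in `n`, leaves
at most a proportion `exp (-(β * q))` (`exists_restriction`). Only edges whose value is not yet
forced are set, so consistency is never lost, and width is counted outside the forced edges. Since
every cut has even size, the forced edges all touch a vertex set of size linear in the number of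
restricted edges (`exists_cover_of_cut_le_one`), so they can be set as well. A refutation with fewer
than `exp (β * q)` monomials would then have low width after the restriction.

If `n` is even, the low-width argument works with no restriction and no width bound. -/

namespace TseitinSOS

open Finset

/-! ### Positive semidefinite kernels of equivalence type -/

/-- A signed indicator function of an equivalence relation, with multiplicative signs, is a
positive semidefinite kernel. -/
theorem sum_kernel_nonneg {ι : Type*} (Λ : Finset ι) (K : ι → ι → ℝ) (a : ι → ℝ)
    (hone : ∀ i ∈ Λ, K i i = 1) (hsymm : ∀ i j, K i j = K j i)
    (hsq : ∀ i j, K i j ≠ 0 → K i j * K i j = 1)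
    (htrans : ∀ i ∈ Λ, ∀ j ∈ Λ, ∀ l ∈ Λ, K i j ≠ 0 → K j l ≠ 0 → K i j * K j l = K i l) :
    0 ≤ ∑ i ∈ Λ, ∑ j ∈ Λ, a i * a j * K i j := by
  -- The case `K j l = 0` follows from `htrans` along `j, i, l`: otherwise the relation would lead
  -- from `j` through `i` to `l`.
  have hmul : ∀ i ∈ Λ, ∀ j ∈ Λ, ∀ l ∈ Λ, K i j ≠ 0 → K i j * K j l = K i l := by
    intro i hi j hj l hl hij
    by_cases hjl : K j l = 0
    · by_contra hne
      rw [hjl, mul_zero] at hne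
      have := htrans j hj i hi l hl (by rwa [hsymm]) (Ne.symm hne)
      rw [hjl, hsymm j i] at this
      exact (mul_ne_zero hij (Ne.symm hne)) this
    · exact htrans i hi j hj l hl hij hjl
  -- `N i` is the size of the class of `i`. Dividing by it makes `K` its own convolution square,
  -- which writes the form as a weighted sum of squares.
  set N : ι → ℝ := fun i => ∑ j ∈ Λ, K i j * K i j with hN
  have hNpos : ∀ i ∈ Λ, 0 < N i := by
    intro i hi
    have h1 : K i i * K i i ≤ N i :=
      single_le_sum (f := fun j => K i j * K i j) (fun j _ => mul_self_nonneg _) hi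
    rw [hone i hi] at h1
    linarith
  have hNeq : ∀ i ∈ Λ, ∀ j ∈ Λ, K i j ≠ 0 → N i = N j := by
    intro i hi j hj hij
    refine sum_congr rfl fun l hl => ?_
    rw [← hmul i hi j hj l hl hij]
    linear_combination (K j l * K j l) * hsq i j hij
  have hconv : ∀ i ∈ Λ, ∀ l ∈ Λ, ∑ j ∈ Λ, K i j * K j l / N j = K i l := by
    intro i hi l hl
    have : ∀ j ∈ Λ, K i j * K j l / N j = K i j * K i j * (K i l / N i) := by
      intro j hj
      by_cases hij : K i j = 0
      · simp [hij]
      · rw [hmul i hi j hj l hl hij, hsq i j hij, hNeq i hi j hj hij, one_mul]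
    rw [sum_congr rfl this, ← sum_mul]
    exact mul_div_cancel₀ _ (hNpos i hi).ne'
  have hmain : ∑ i ∈ Λ, ∑ j ∈ Λ, a i * a j * K i j
      = ∑ j ∈ Λ, (∑ i ∈ Λ, a i * K i j) ^ 2 / N j := by
    calc ∑ i ∈ Λ, ∑ l ∈ Λ, a i * a l * K i l
        = ∑ i ∈ Λ, ∑ l ∈ Λ, ∑ j ∈ Λ, a i * a l * (K i j * K j l / N j) := by
          refine sum_congr rfl fun i hi => sum_congr rfl fun l hl => ?_
          rw [← mul_sum, hconv i hi l hl]
      _ = ∑ i ∈ Λ, ∑ j ∈ Λ, ∑ l ∈ Λ, a i * a l * (K i j * K j l / N j) :=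
          sum_congr rfl fun i _ => sum_comm
      _ = ∑ j ∈ Λ, ∑ i ∈ Λ, ∑ l ∈ Λ, a i * a l * (K i j * K j l / N j) := sum_comm
      _ = _ := by
          refine sum_congr rfl fun j _ => ?_
          rw [sq, sum_mul_sum, sum_div]
          refine sum_congr rfl fun i _ => ?_
          rw [sum_div]
          refine sum_congr rfl fun l _ => ?_
          rw [hsymm j l]
          ring
  rw [hmain]
  exact sum_nonneg fun j hj => div_nonneg (sq_nonneg _) (hNpos j hj).le

/-! ### Signs -/

/-- The real sign `(-1) ^ a`. -/
def sgn (a : ZMod 2) : ℝ := if a = 0 then 1 else -1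

theorem zmod_two_cases (a : ZMod 2) : a = 0 ∨ a = 1 := by
  revert a
  decide

@[simp] theorem sgn_zero : sgn 0 = 1 := by simp [sgn]

@[simp] theorem sgn_one : sgn 1 = -1 := by simp [sgn]

theorem sgn_add (a b : ZMod 2) : sgn (a + b) = sgn a * sgn b := by
  have h : (1 + 1 : ZMod 2) = 0 := by decide
  rcases zmod_two_cases a with rfl | rfl <;> rcases zmod_two_cases b with rfl | rfl <;>
    simp [h]

theorem sgn_mul_self (a : ZMod 2) : sgn a * sgn a = 1 := by
  rcases zmod_two_cases a with rfl | rfl <;> simp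

theorem sgn_ne_zero (a : ZMod 2) : sgn a ≠ 0 := by
  rcases zmod_two_cases a with rfl | rfl <;> simp

theorem sgn_sum {ι : Type*} (s : Finset ι) (f : ι → ZMod 2) :
    sgn (∑ i ∈ s, f i) = ∏ i ∈ s, sgn (f i) := by
  classical
  induction s using Finset.induction_on with
  | empty => simp
  | insert i s hi ih => rw [sum_insert hi, prod_insert hi, sgn_add, ih]

/-! ### The restricted character ring -/

/-- The group ring of formal real combinations of characters of the cube `σ → ZMod 2`. -/
abbrev CharRing (σ : Type*) : Type _ := AddMonoidAlgebra ℝ (σ → ZMod 2)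

theorem half_smul_eq {σ : Type*} (x : CharRing σ) : (1 / 2 : ℝ) • x = algebraMap ℝ _ (1 / 2) * x :=
  Algebra.smul_def _ _

theorem two_mul_half {σ : Type*} : (2 : CharRing σ) * algebraMap ℝ _ (1 / 2) = 1 := by
  rw [← map_ofNat (algebraMap ℝ (CharRing σ)) 2, ← map_mul,
    mul_one_div_cancel two_ne_zero, map_one]

section Characters

variable {σ : Type*} [DecidableEq σ]

/-- The value of `1 - 2 x e` under the restriction that sets `x e` to `ρ e` for `e ∈ R`. -/
noncomputable def char (R : Finset σ) (ρ : σ → ZMod 2) (e : σ) : CharRing σ :=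
  AddMonoidAlgebra.single (if e ∈ R then 0 else Pi.single e 1) (if e ∈ R then sgn (ρ e) else 1)

/-- The images of the twin variables in the restricted character ring. -/
noncomputable def charVar (R : Finset σ) (ρ : σ → ZMod 2) : σ ⊕ σ → CharRing σ :=
  Sum.elim (fun e => (1 / 2 : ℝ) • (1 - char R ρ e)) (fun e => (1 / 2 : ℝ) • (1 + char R ρ e))

/-- The restriction of a polynomial, expanded in characters. -/
noncomputable def restrict (R : Finset σ) (ρ : σ → ZMod 2) : TwinPoly σ →ₐ[ℝ] CharRing σ :=
  MvPolynomial.aeval (charVar R ρ)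

theorem char_mul_self (R : Finset σ) (ρ : σ → ZMod 2) (e : σ) : char R ρ e * char R ρ e = 1 := by
  have h : ∀ x : σ → ZMod 2, x + x = 0 := fun x => by
    funext i
    exact CharTwo.add_self_eq_zero _
  rw [char, AddMonoidAlgebra.single_mul_single, h, AddMonoidAlgebra.one_def]
  congr 1
  split_ifs
  · exact sgn_mul_self _
  · norm_num

theorem restrict_basic (R : Finset σ) (ρ : σ → ZMod 2) (e : σ) :
    restrict R ρ (TwinPoly.basic e) = (1 / 2 : ℝ) • (1 - char R ρ e) := by
  simp [restrict, TwinPoly.basic, charVar]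

theorem restrict_twin (R : Finset σ) (ρ : σ → ZMod 2) (e : σ) :
    restrict R ρ (TwinPoly.twin e) = (1 / 2 : ℝ) • (1 + char R ρ e) := by
  simp [restrict, TwinPoly.twin, charVar]

theorem restrict_one_sub_two_mul (R : Finset σ) (ρ : σ → ZMod 2) (e : σ) :
    restrict R ρ (1 - 2 * TwinPoly.basic e) = char R ρ e := by
  rw [map_sub, map_one, map_mul, restrict_basic, map_ofNat, half_smul_eq]
  linear_combination (char R ρ e - 1) * two_mul_half (σ := σ)

theorem restrict_bool_basic (R : Finset σ) (ρ : σ → ZMod 2) (e : σ) :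
    restrict R ρ (TwinPoly.basic e ^ 2 - TwinPoly.basic e) = 0 := by
  rw [map_sub, map_pow, restrict_basic, half_smul_eq]
  set c := algebraMap ℝ (CharRing σ) (1 / 2)
  linear_combination c ^ 2 * char_mul_self R ρ e + (c - c * char R ρ e) * two_mul_half (σ := σ)

theorem restrict_bool_twin (R : Finset σ) (ρ : σ → ZMod 2) (e : σ) :
    restrict R ρ (TwinPoly.twin e ^ 2 - TwinPoly.twin e) = 0 := by
  rw [map_sub, map_pow, restrict_twin, half_smul_eq]
  set c := algebraMap ℝ (CharRing σ) (1 / 2)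
  linear_combination c ^ 2 * char_mul_self R ρ e + (c + c * char R ρ e) * two_mul_half (σ := σ)

theorem restrict_bool_sum (R : Finset σ) (ρ : σ → ZMod 2) (e : σ) :
    restrict R ρ (TwinPoly.basic e + TwinPoly.twin e - 1) = 0 := by
  rw [map_sub, map_add, restrict_twin, restrict_basic, half_smul_eq, half_smul_eq, map_one]
  linear_combination two_mul_half (σ := σ)

/-- The monomial `m` contains a literal that the restriction `ρ` on `R` sets to zero. -/
def Killed (R : Finset σ) (ρ : σ → ZMod 2) (m : σ ⊕ σ →₀ ℕ) : Prop :=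
  ∃ e ∈ R, (ρ e = 0 ∧ m (Sum.inl e) ≠ 0) ∨ (ρ e = 1 ∧ m (Sum.inr e) ≠ 0)

theorem restrict_monomial_eq_zero {R : Finset σ} {ρ : σ → ZMod 2} {m : σ ⊕ σ →₀ ℕ}
    (h : Killed R ρ m) (a : ℝ) : restrict R ρ (MvPolynomial.monomial m a) = 0 := by
  obtain ⟨e, he, h⟩ := h
  have key : ∀ l, m l ≠ 0 → charVar R ρ l = 0 →
      restrict R ρ (MvPolynomial.monomial m a) = 0 := by
    intro l hl h0
    rw [restrict, MvPolynomial.aeval_monomial, Finsupp.prod,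
      prod_eq_zero (Finsupp.mem_support_iff.2 hl), mul_zero]
    rw [h0, zero_pow hl]
  rcases h with ⟨h0, hm⟩ | ⟨h1, hm⟩
  · refine key _ hm ?_
    simp [charVar, char, he, h0, AddMonoidAlgebra.one_def]
  · refine key _ hm ?_
    simp only [charVar, char, he, h1, AddMonoidAlgebra.one_def, if_true, Sum.elim_inr, sgn_one]
    rw [← AddMonoidAlgebra.single_add]
    simp

variable [Fintype σ]

/-- The indices of the variables that occur in the monomial `m`. -/
def width (m : σ ⊕ σ →₀ ℕ) : Finset σ :=
  univ.filter fun e => m (Sum.inl e) ≠ 0 ∨ m (Sum.inr e) ≠ 0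

/-- The elements of the character ring whose characters are supported in `W`. -/
def supportedIn (W : Finset σ) : Subalgebra ℝ (CharRing σ) where
  carrier := {f | ∀ T, f.coeff T ≠ 0 → ∀ e ∉ W, T e = 0}
  mul_mem' := by
    intro f g hf hg T hT e he
    have h := AddMonoidAlgebra.support_coeff_mul_subset f g (Finsupp.mem_support_iff.2 hT)
    obtain ⟨T₁, h₁, T₂, h₂, rfl⟩ := Finset.mem_add.1 h
    rw [Pi.add_apply, hf T₁ (Finsupp.mem_support_iff.1 h₁) e he,
      hg T₂ (Finsupp.mem_support_iff.1 h₂) e he, add_zero]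
  add_mem' := by
    intro f g hf hg T hT e he
    by_cases h : f.coeff T = 0
    · by_cases h' : g.coeff T = 0
      · exact absurd (by simp [h, h']) hT
      · exact hg T h' e he
    · exact hf T h e he
  algebraMap_mem' := by
    intro r T hT e _
    by_contra hne
    refine hT ?_
    have h0 : (0 : σ → ZMod 2) ≠ T := by
      rintro rfl
      exact hne rfl
    simp [Algebra.algebraMap_eq_smul_one, AddMonoidAlgebra.one_def, h0]

/-- Each literal becomes a combination of 1 and its own character, and that character is a constant
for an edge in `R`. -/
theorem restrict_monomial_mem (R : Finset σ) (ρ : σ → ZMod 2) (m : σ ⊕ σ →₀ ℕ) (a : ℝ) :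
    restrict R ρ (MvPolynomial.monomial m a) ∈ supportedIn (width m \ R) := by
  rw [restrict, MvPolynomial.aeval_monomial]
  refine mul_mem (Subalgebra.algebraMap_mem _ _) (prod_mem fun l hl => pow_mem ?_ _)
  have hchar : ∀ e ∈ width m, char R ρ e ∈ supportedIn (width m \ R) := by
    intro e he T hT e' he'
    by_contra hne
    refine hT ?_
    rw [char, AddMonoidAlgebra.coeff_single, Finsupp.single_apply, if_neg]
    rintro rfl
    refine hne ?_
    split_ifs with hR
    · rfl
    · refine Pi.single_eq_of_ne ?_ _
      rintro rfl
      exact he' (mem_sdiff.2 ⟨he, hR⟩)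
  rw [Finsupp.mem_support_iff] at hl
  rcases l with e | e
  · exact Subalgebra.smul_mem _ (sub_mem (one_mem _) (hchar e (by simp [width, hl]))) _
  · exact Subalgebra.smul_mem _ (add_mem (one_mem _) (hchar e (by simp [width, hl]))) _

/-- The elements of the character ring all of whose characters have weight at most `k`. -/
def lowWeight (σ : Type*) [Fintype σ] (k : ℕ) : Submodule ℝ (CharRing σ) where
  carrier := {f | ∀ T, f.coeff T ≠ 0 → hammingNorm T ≤ k}
  add_mem' := by
    intro f g hf hg T hT
    by_cases h : f.coeff T = 0
    · by_cases h' : g.coeff T = 0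
      · exact absurd (by simp [h, h']) hT
      · exact hg T h'
    · exact hf T h
  zero_mem' := fun T hT => absurd rfl hT
  smul_mem' := by
    intro c f hf T hT
    exact hf T fun h => hT (by simp [h])

theorem restrict_mem_lowWeight {R : Finset σ} {ρ : σ → ZMod 2} {k : ℕ} (p : TwinPoly σ)
    (h : ∀ m ∈ p.support, Killed R ρ m ∨ (width m \ R).card ≤ k) :
    restrict R ρ p ∈ lowWeight σ k := by
  rw [p.as_sum, map_sum]
  refine Submodule.sum_mem _ fun m hm => ?_
  rcases h m hm with hk | hk
  · rw [restrict_monomial_eq_zero hk]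
    exact Submodule.zero_mem _
  · intro T hT
    refine le_trans (card_le_card fun e he => ?_) hk
    by_contra hne
    exact (mem_filter.1 he).2 (restrict_monomial_mem R ρ m _ T hT e hne)

/-- The linear functional on the character ring with the given values at the characters. -/
noncomputable def functional (K : (σ → ZMod 2) → ℝ) : CharRing σ →ₗ[ℝ] ℝ where
  toFun f := ∑ T, f.coeff T * K T
  map_add' f g := by simp [add_mul, sum_add_distrib]
  map_smul' c f := by simp [mul_sum, mul_assoc]

theorem functional_single (K : (σ → ZMod 2) → ℝ) (T : σ → ZMod 2) (a : ℝ) :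
    functional K (AddMonoidAlgebra.single T a) = a * K T := by
  simp [functional, AddMonoidAlgebra.coeff_single, Finsupp.single_apply]

theorem sum_single_coeff (f : CharRing σ) :
    f = ∑ T, AddMonoidAlgebra.single T (f.coeff T) := by
  apply AddMonoidAlgebra.coeff_injective
  ext T
  simp [AddMonoidAlgebra.coeff_sum]

theorem functional_mul (K : (σ → ZMod 2) → ℝ) (f g : CharRing σ) :
    functional K (f * g) = ∑ T, ∑ S, f.coeff T * g.coeff S * K (T + S) := by
  conv_lhs => rw [sum_single_coeff f, sum_single_coeff g, sum_mul_sum]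
  simp only [map_sum, AddMonoidAlgebra.single_mul_single, functional_single]

end Characters

theorem pi_add_self {ι : Type*} (x : ι → ZMod 2) : x + x = 0 := by
  funext i
  exact CharTwo.add_self_eq_zero _

theorem hammingNorm_add_le {ι : Type*} [Fintype ι] (x y : ι → ZMod 2) :
    hammingNorm (x + y) ≤ hammingNorm x + hammingNorm y := by
  classical
  refine le_trans (card_le_card fun i hi => ?_) (card_union_le _ _)
  simp only [mem_filter, mem_univ, true_and, Pi.add_apply, mem_union] at hi ⊢
  by_contra h
  push Not at h
  exact hi (by rw [h.1, h.2, add_zero])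

/-! ### Boundaries of vertex sets -/

section Boundary

variable {V : Type*} [Fintype V] [DecidableEq V] (G : SimpleGraph V)

/-- The edge boundary of a vertex set, both given by their indicator functions. -/
def bd (A : V → ZMod 2) (e : G.edgeSet) : ZMod 2 :=
  ∑ v ∈ univ.filter (fun v => v ∈ (e : Sym2 V)), A v

theorem bd_add (A B : V → ZMod 2) : bd G (A + B) = bd G A + bd G B := by
  funext e
  simp [bd, sum_add_distrib]

theorem bd_zero : bd G 0 = 0 := by
  funext e
  simp [bd]

theorem bd_single (u : V) (e : G.edgeSet) :
    bd G (Pi.single u 1) e = if u ∈ (e : Sym2 V) then 1 else 0 := by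
  simp [bd, Pi.single_apply]

/-- The part of the edge boundary outside the restricted edges. -/
noncomputable def coreBd (R : Finset G.edgeSet) (A : V → ZMod 2) (e : G.edgeSet) : ZMod 2 :=
  if e ∈ R then 0 else bd G A e

theorem coreBd_add (R : Finset G.edgeSet) (A B : V → ZMod 2) :
    coreBd G R (A + B) = coreBd G R A + coreBd G R B := by
  funext e
  by_cases h : e ∈ R <;> simp [coreBd, bd_add, h]

theorem coreBd_zero (R : Finset G.edgeSet) : coreBd G R 0 = 0 := by
  funext e
  simp [coreBd, bd_zero]

/-- The parity that the constraints in `A` and the restriction `ρ` of `R` impose on the sum of the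
variables in the boundary of `A` outside `R`. -/
noncomputable def charge (R : Finset G.edgeSet) (ρ : G.edgeSet → ZMod 2)
    (A : V → ZMod 2) : ZMod 2 :=
  ∑ v, A v + ∑ e ∈ R, bd G A e * ρ e

theorem charge_add {G : SimpleGraph V} (R : Finset G.edgeSet) (ρ : G.edgeSet → ZMod 2)
    (A B : V → ZMod 2) : charge G R ρ (A + B) = charge G R ρ A + charge G R ρ B := by
  simp only [charge, bd_add, Pi.add_apply, sum_add_distrib, add_mul]
  ring

theorem charge_zero {G : SimpleGraph V} (R : Finset G.edgeSet) (ρ : G.edgeSet → ZMod 2) :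
    charge G R ρ 0 = 0 := by
  simp [charge, bd_zero]

variable [DecidableRel G.Adj]

theorem hammingNorm_coreBd_le (R : Finset G.edgeSet) (A : V → ZMod 2) :
    hammingNorm (coreBd G R A) ≤ hammingNorm (bd G A) := by
  refine card_le_card fun e he => ?_
  refine mem_filter.2 ⟨mem_univ _, fun h => (mem_filter.1 he).2 ?_⟩
  simp [coreBd, h]

variable {G}

/-- The Tseitin constraint at `u`, restricted and written in characters. -/
theorem restrict_tseitinPoly (R : Finset G.edgeSet) (ρ : G.edgeSet → ZMod 2) (u : V) :
    restrict R ρ (tseitinPoly G u) = 1 +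
      AddMonoidAlgebra.single (coreBd G R (Pi.single u 1))
        (-sgn (charge G R ρ (Pi.single u 1))) := by
  rw [tseitinPoly, map_add, map_prod, map_one, add_comm]
  congr 1
  simp only [restrict_one_sub_two_mul, char]
  have hprod : ∀ (s : Finset G.edgeSet) (f : G.edgeSet → G.edgeSet → ZMod 2) (c : G.edgeSet → ℝ),
      ∏ e ∈ s, (AddMonoidAlgebra.single (f e) (c e) : CharRing G.edgeSet)
        = AddMonoidAlgebra.single (∑ e ∈ s, f e) (∏ e ∈ s, c e) := by
    intro s f c
    induction s using Finset.induction_on with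
    | empty => simp [AddMonoidAlgebra.one_def]
    | insert i s hi ih =>
      rw [prod_insert hi, sum_insert hi, prod_insert hi, ih, AddMonoidAlgebra.single_mul_single]
  rw [hprod]
  congr 1
  · funext e
    simp only [Finset.sum_apply, coreBd, bd_single, sum_filter]
    rw [sum_eq_single e]
    · split_ifs <;> simp
    · intro e' _ hne
      split_ifs <;> simp [hne.symm]
    · simp
  · rw [charge, sgn_add, sum_pi_single', if_pos (mem_univ _), sgn_one, neg_one_mul, neg_neg, sgn_sum,
      prod_filter]
    rw [← prod_subset (subset_univ R)]
    · refine prod_congr rfl fun e he => ?_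
      rw [bd_single]
      split_ifs <;> simp
    · intro e _ he
      simp [he]

/-- A family of vertex sets on which charges are consistent gives a pseudo-expectation at the
characters. -/
theorem exists_charValue (R : Finset G.edgeSet) (ρ : G.edgeSet → ZMod 2)
    (P : (V → ZMod 2) → Prop)
    (hcons : ∀ A B, P A → P B → coreBd G R (A + B) = 0 → charge G R ρ (A + B) = 0) :
    ∃ K : (G.edgeSet → ZMod 2) → ℝ,
      (∀ A, P A → K (coreBd G R A) = sgn (charge G R ρ A)) ∧
      ∀ T, K T ≠ 0 → ∃ A, P A ∧ coreBd G R A = T := by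
  classical
  -- Two sets in `P` with the same boundary outside `R` have the same charge by `hcons`, so the
  -- chosen representative does not matter.
  refine ⟨fun T => if h : ∃ A, P A ∧ coreBd G R A = T then sgn (charge G R ρ h.choose) else 0,
    fun A hA => ?_, fun T hT => ?_⟩
  · have h : ∃ B, P B ∧ coreBd G R B = coreBd G R A := ⟨A, hA, rfl⟩
    simp only [dif_pos h]
    have h0 := hcons _ _ h.choose_spec.1 hA
      (by rw [coreBd_add, h.choose_spec.2, pi_add_self])
    rw [charge_add, CharTwo.add_eq_zero] at h0
    rw [h0]
  · by_contra h
    exact hT (dif_neg h)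

/-- There is no refutation whose monomials all are killed by a restriction or have low width after
it, if the restricted Tseitin formula is consistent on an expanding family of vertex sets. -/
theorem no_low_width_refutation (R : Finset G.edgeSet) (ρ : G.edgeSet → ZMod 2) (k : ℕ)
    (P : (V → ZMod 2) → Prop) (hzero : P 0)
    (hcons : ∀ A B, P A → P B → coreBd G R (A + B) = 0 → charge G R ρ (A + B) = 0)
    (hadd : ∀ A B, P A → P B → hammingNorm (coreBd G R (A + B)) ≤ 2 * k → P (A + B))
    (hvert : ∀ A u, P A → hammingNorm (coreBd G R (A + Pi.single u 1)) ≤ 2 * k →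
      P (A + Pi.single u 1))
    (hdeg : ∀ u, hammingNorm (bd G (Pi.single u 1)) ≤ k)
    (Q : TseitinRefutation G)
    (hsq : ∀ r ∈ Q.r₀, ∀ m ∈ r.support, Killed R ρ m ∨ (width m \ R).card ≤ k)
    (hmul : ∀ u, ∀ m ∈ (Q.t u).support, Killed R ρ m ∨ (width m \ R).card ≤ k) : False := by
  classical
  obtain ⟨K, hK, hKne⟩ := exists_charValue R ρ P hcons
  have hK0 : K 0 = 1 := by
    have := hK 0 hzero
    rwa [coreBd_zero, charge_zero, sgn_zero] at this
  have hvalue : ∀ T, K T ≠ 0 → K T * K T = 1 := by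
    intro T hT
    obtain ⟨A, hA, rfl⟩ := hKne T hT
    rw [hK A hA, sgn_mul_self]
  -- The sums are cut down to the support of `f`: transitivity of the kernel needs `T + U` to have
  -- weight at most `2 * k`, so that `hadd` applies.
  have hL1 : ∀ f ∈ lowWeight G.edgeSet k, 0 ≤ functional K (f ^ 2) := by
    intro f hf
    have hlow : functional K (f ^ 2) = ∑ T ∈ univ.filter (fun T => f.coeff T ≠ 0),
        ∑ S ∈ univ.filter (fun S => f.coeff S ≠ 0), f.coeff T * f.coeff S * K (T + S) := by
      rw [sq, functional_mul, sum_filter]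
      refine sum_congr rfl fun T _ => ?_
      split_ifs with hT
      · rw [sum_filter]
        refine sum_congr rfl fun S _ => ?_
        split_ifs with hS
        · rfl
        · push Not at hS
          simp [hS]
      · push Not at hT
        simp [hT]
    rw [hlow]
    refine sum_kernel_nonneg _ (fun T S => K (T + S)) _ ?_ ?_ ?_ ?_
    · intro T _
      rw [pi_add_self, hK0]
    · intro T S
      rw [add_comm]
    · intro T S h
      exact hvalue _ h
    · intro T hT S _ U hU h₁ h₂
      obtain ⟨A, hA, hAT⟩ := hKne _ h₁
      obtain ⟨B, hB, hBS⟩ := hKne _ h₂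
      have hAB : coreBd G R (A + B) = T + U := by
        rw [coreBd_add, hAT, hBS]
        calc T + S + (S + U) = T + (S + S) + U := by abel
          _ = T + U := by rw [pi_add_self, add_zero]
      have hPAB : P (A + B) := by
        refine hadd A B hA hB ?_
        rw [hAB]
        refine (hammingNorm_add_le _ _).trans ?_
        have := hf T (mem_filter.1 hT).2
        have := hf U (mem_filter.1 hU).2
        omega
      change K (T + S) * K (S + U) = K (T + U)
      rw [← hAT, ← hBS, ← hAB, hK A hA, hK B hB, hK _ hPAB, charge_add, sgn_add]
  have hL2 : ∀ u, ∀ f ∈ lowWeight G.edgeSet k,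
      functional K (f * restrict R ρ (tseitinPoly G u)) = 0 := by
    intro u f hf
    set b := coreBd G R (Pi.single u 1) with hb
    set c := charge G R ρ (Pi.single u 1) with hc
    have hbk : hammingNorm b ≤ k := (hammingNorm_coreBd_le G R _).trans (hdeg u)
    have hshift : ∀ T, K T ≠ 0 → hammingNorm (T + b) ≤ 2 * k → K (T + b) = sgn c * K T := by
      intro T hT hTb
      obtain ⟨A, hA, rfl⟩ := hKne T hT
      rw [hb, ← coreBd_add] at hTb ⊢
      rw [hK _ (hvert A u hA hTb), hK A hA, charge_add, sgn_add, mul_comm]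
    have hTb : ∀ T, f.coeff T ≠ 0 → K (T + b) = sgn c * K T := by
      intro T hT
      have hTk := hf T hT
      have h1 := hammingNorm_add_le T b
      by_cases h : K T = 0
      -- A non-zero value at `T + b` would be carried back to `T` by a second shift by `b`.
      · by_contra hne
        rw [h, mul_zero] at hne
        have hTbb : T + b + b = T := by rw [add_assoc, pi_add_self, add_zero]
        have h2 := hshift (T + b) hne (by rw [hTbb]; omega)
        rw [hTbb, h] at h2
        exact (mul_ne_zero (sgn_ne_zero c) hne) h2.symm
      · exact hshift T h (by omega)
    rw [restrict_tseitinPoly, ← hb, ← hc]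
    conv_lhs => rw [sum_single_coeff f]
    rw [mul_add, mul_one, map_add, sum_mul]
    simp only [map_sum, AddMonoidAlgebra.single_mul_single, functional_single]
    rw [← sum_add_distrib]
    refine sum_eq_zero fun T _ => ?_
    by_cases hT : f.coeff T = 0
    · simp [hT]
    · rw [hTb T hT]
      linear_combination (-(f.coeff T) * K T) * sgn_mul_self c
  -- The restricted identity has lost its Boolean axioms; the functional sends its left side to
  -- `-1`, the constraint part to 0 and the squares to a non-negative number.
  have hid := congrArg (restrict R ρ) Q.identity
  simp only [map_add, map_sum, map_mul, univ_eq_empty, sum_empty, restrict_bool_basic,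
    restrict_bool_twin, restrict_bool_sum, mul_zero, sum_const_zero, add_zero] at hid
  have hL := congrArg (functional K) hid
  rw [map_add, map_sum, sum_eq_zero (fun u _ => hL2 u _ (restrict_mem_lowWeight _ (hmul u))),
    add_zero, map_neg, map_neg, map_one] at hL
  have hone : functional K (1 : CharRing G.edgeSet) = 1 := by
    rw [AddMonoidAlgebra.one_def, functional_single, hK0, one_mul]
  have hnonneg : 0 ≤ functional K (restrict R ρ (TwinPoly.sumSq Q.r₀)) := by
    rw [TwinPoly.sumSq, map_list_sum, map_list_sum, List.map_map, List.map_map]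
    refine List.sum_nonneg fun x hx => ?_
    obtain ⟨r, hr, rfl⟩ := List.mem_map.1 hx
    simp only [Function.comp, map_pow]
    exact hL1 _ (restrict_mem_lowWeight _ (hsq r hr))
  rw [hone] at hL
  linarith

end Boundary

/-! ### Edge expansion, and cuts relative to a set of restricted edges -/

section Expansion

/-- The number of edges in `R` at the vertex `v`. -/
def degIn {V : Type*} [DecidableEq V] {G : SimpleGraph V} (R : Finset G.edgeSet) (v : V) : ℕ :=
  (R.filter fun e : G.edgeSet => v ∈ (e : Sym2 V)).card

theorem sum_degIn_le {V : Type*} [DecidableEq V] {G : SimpleGraph V} (R : Finset G.edgeSet)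
    (X : Finset V) :
    ∑ v ∈ X, degIn R v ≤ 2 * R.card := by
  simp only [degIn, card_filter]
  rw [sum_comm, mul_comm, ← smul_eq_mul, ← sum_const]
  refine sum_le_sum fun e _ => ?_
  rw [← card_filter]
  obtain ⟨e, he⟩ := e
  induction e using Sym2.ind with
  | _ a b =>
    refine le_trans (card_le_card (t := {a, b}) fun v hv => ?_) card_le_two
    simpa using (mem_filter.1 hv).2

theorem card_edges_eq {V : Type*} [Fintype V] {G : SimpleGraph V} [DecidableRel G.Adj]
    {p : Sym2 V → Prop} [DecidablePred p] :
    (univ.filter fun e : G.edgeSet => p e).card = (G.edgeFinset.filter p).card := by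
  rw [← card_map (Function.Embedding.subtype (· ∈ G.edgeSet))]
  congr 1
  ext e
  simp [and_comm]

theorem two_mul_card_edgeSet {V : Type*} [Fintype V] {G : SimpleGraph V} [DecidableRel G.Adj] {d : ℕ}
    (hd : G.IsRegularOfDegree d) :
    2 * Fintype.card G.edgeSet = Fintype.card V * d := by
  rw [← SimpleGraph.edgeFinset_card, ← G.sum_degrees_eq_twice_card_edges]
  simp [hd.degree_eq]

variable {V : Type*} [Fintype V] [DecidableEq V] {G : SimpleGraph V}

theorem bd_mk (A : V → ZMod 2) {a b : V} (h : s(a, b) ∈ G.edgeSet) :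
    bd G A ⟨s(a, b), h⟩ = A a + A b := by
  have hab : a ≠ b := G.ne_of_adj h
  have : univ.filter (fun v => v ∈ s(a, b)) = {a, b} := by
    ext v
    simp
  rw [bd, this, sum_pair hab]

/-- The indicator function of a vertex set. -/
def ind (X : Finset V) (v : V) : ZMod 2 := if v ∈ X then 1 else 0

theorem ind_support (A : V → ZMod 2) : ind (univ.filter fun v => A v ≠ 0) = A := by
  funext v
  rcases zmod_two_cases (A v) with h | h <;> simp [ind, h]

theorem hammingNorm_ind (X : Finset V) : hammingNorm (ind X) = X.card := by
  simp [hammingNorm, ind]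

theorem bd_one : bd G 1 = 0 := by
  funext ⟨e, he⟩
  induction e using Sym2.ind with
  | _ a b =>
    rw [bd_mk]
    exact CharTwo.add_self_eq_zero _

variable [DecidableRel G.Adj]

variable (G) in
/-- The edges with exactly one endpoint in `X`. -/
def cut (X : Finset V) : Finset G.edgeSet := univ.filter fun e => bd G (ind X) e ≠ 0

theorem hammingNorm_bd_ind (X : Finset V) : hammingNorm (bd G (ind X)) = (cut G X).card := rfl

theorem mem_cut_mk {X : Finset V} {a b : V} (h : s(a, b) ∈ G.edgeSet) :
    (⟨s(a, b), h⟩ : G.edgeSet) ∈ cut G X ↔ ¬ (a ∈ X ↔ b ∈ X) := by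
  simp only [cut, mem_filter, mem_univ, true_and, bd_mk, ind]
  by_cases ha : a ∈ X <;> by_cases hb : b ∈ X <;> simp [ha, hb, CharTwo.add_self_eq_zero]

theorem hammingNorm_bd_single (u : V) : hammingNorm (bd G (Pi.single u 1)) = G.degree u := by
  rw [← G.card_incidenceFinset_eq_degree, G.incidenceFinset_eq_filter,
    ← card_edges_eq (p := fun e => u ∈ e), hammingNorm]
  congr 1
  ext e
  simp [bd_single]

theorem le_hammingNorm_bd {c : ℝ} (hG : HasEdgeExpansion G c) (A : V → ZMod 2)
    (hA : 2 * hammingNorm A ≤ Fintype.card V) : c * hammingNorm A ≤ hammingNorm (bd G A) := by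
  set X := univ.filter fun v => A v ≠ 0 with hX
  refine (hG X hA).trans ?_
  rw [← ind_support A, ← hX, hammingNorm_bd_ind, Nat.cast_le,
    ← card_map (Function.Embedding.subtype (· ∈ G.edgeSet))]
  refine card_le_card_of_injOn (fun p => s(p.1, p.2)) ?_ ?_
  · rintro ⟨a, b⟩ hp
    have hp := (G.mem_interedges_iff).1 (mem_coe.1 hp)
    simp only [mem_compl] at hp
    simp only [coe_map, Set.mem_image, mem_coe]
    exact ⟨⟨s(a, b), hp.2.2⟩, (mem_cut_mk hp.2.2).2 (by tauto), rfl⟩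
  · rintro ⟨a, b⟩ hp ⟨a', b'⟩ hp' h
    have hp := (G.mem_interedges_iff).1 (mem_coe.1 hp)
    have hp' := (G.mem_interedges_iff).1 (mem_coe.1 hp')
    simp only [mem_compl] at hp hp'
    rcases Sym2.eq_iff.1 h with ⟨rfl, rfl⟩ | ⟨rfl, rfl⟩
    · rfl
    · exact absurd hp'.1 hp.2.1

theorem eq_zero_of_bd_eq_zero {c : ℝ} (hc : 0 < c) (hG : HasEdgeExpansion G c) {A : V → ZMod 2}
    (hA : 2 * hammingNorm A ≤ Fintype.card V) (h : bd G A = 0) : A = 0 := by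
  have h1 := le_hammingNorm_bd hG A hA
  rw [h, hammingNorm_zero, Nat.cast_zero] at h1
  have h2 : (hammingNorm A : ℝ) ≤ 0 := by
    by_contra hlt
    push Not at hlt
    linarith [mul_pos hc hlt]
  exact hammingNorm_eq_zero.1 (by exact_mod_cast le_antisymm h2 (Nat.cast_nonneg _))

/-- The Tseitin formula of an expander with an even number of vertices has no refutation. -/
theorem no_refutation_of_even {c : ℝ} (hc : 0 < c) (hG : HasEdgeExpansion G c)
    (hV : Even (Fintype.card V)) (Q : TseitinRefutation G) : False := by
  have hcore : ∀ A, coreBd G ∅ A = bd G A := fun A => by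
    funext e
    simp [coreBd]
  -- All vertex sets are admitted, and `k` is the number of all edges, so the width conditions hold
  -- trivially. What remains is that a set with empty boundary has even size.
  refine no_low_width_refutation ∅ 0 (Fintype.card G.edgeSet) (fun _ => True) trivial ?_
    (fun _ _ _ _ _ => trivial) (fun _ _ _ _ => trivial) (fun u => hammingNorm_le_card_fintype) Q
    (fun _ _ m _ => Or.inr (card_le_univ _)) (fun _ m _ => Or.inr (card_le_univ _))
  intro A B _ _ h
  rw [hcore] at h
  generalize A + B = D at h ⊢
  simp only [charge, sum_empty, add_zero]
  by_cases hD : 2 * hammingNorm D ≤ Fintype.card V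
  · rw [eq_zero_of_bd_eq_zero hc hG hD h]
    simp
  -- A set with more than half of the vertices is handled through its complement, which has the same
  -- boundary; it must be the whole of `V`.
  · have hcompl : hammingNorm (D + 1) + hammingNorm D = Fintype.card V := by
      rw [hammingNorm, hammingNorm, ← card_univ,
        ← card_filter_add_card_filter_not (s := univ) (fun v => (D + 1) v ≠ 0)]
      congr 2
      ext v
      have h11 : (1 + 1 : ZMod 2) = 0 := by decide
      rcases zmod_two_cases (D v) with h | h <;> simp [h, h11]
    have hD1 : D + 1 = 0 := eq_zero_of_bd_eq_zero hc hG (by omega)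
      (by rw [bd_add, h, bd_one, add_zero])
    have hD2 : D = 1 := by
      rw [← add_zero D, ← pi_add_self 1, ← add_assoc, hD1, zero_add]
    rw [hD2]
    simpa using (ZMod.natCast_eq_zero_iff_even).2 hV

/-- Modulo 2 the cut size is the sum of the degrees over `X`, since edges inside `X` are counted
twice. -/
theorem even_card_cut {d : ℕ} (hd : G.IsRegularOfDegree d) (hd2 : Even d) (X : Finset V) :
    Even (cut G X).card := by
  rw [← ZMod.natCast_eq_zero_iff_even]
  have h1 : ((cut G X).card : ZMod 2) = ∑ e, bd G (ind X) e := by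
    rw [cut, card_filter, Nat.cast_sum]
    refine sum_congr rfl fun e _ => ?_
    rcases zmod_two_cases (bd G (ind X) e) with h | h <;> simp [h]
  rw [h1]
  simp only [bd, sum_filter]
  rw [sum_comm]
  refine sum_eq_zero fun v _ => ?_
  have h2 : (∑ e : G.edgeSet, if v ∈ (e : Sym2 V) then ind X v else 0)
      = (d : ZMod 2) * ind X v := by
    rw [← sum_filter, sum_const, nsmul_eq_mul, card_edges_eq (p := fun e => v ∈ e),
      ← G.incidenceFinset_eq_filter,
      G.card_incidenceFinset_eq_degree, hd.degree_eq]
  rw [h2, ZMod.natCast_eq_zero_iff_even.2 hd2, zero_mul]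

theorem card_le_of_sdiff {α : Type*} [DecidableEq α] {C C' : Finset α}
    (h : (C' \ C).card ≤ (C \ C').card) : C'.card ≤ C.card := by
  have h1 := card_sdiff_add_card_inter C C'
  have h2 := card_sdiff_add_card_inter C' C
  rw [inter_comm] at h2
  omega

/-- Adding to `X` a vertex set with at most one boundary edge outside `R` increases the number of
boundary edges outside `R` only if an edge in `R` is met. -/
theorem card_cut_union_le {R : Finset G.edgeSet} {X A : Finset V}
    (heven : Even (cut G (A \ X)).card) (hne : (A \ X).Nonempty → (cut G (A \ X)).Nonempty)
    (hA : (cut G A \ R).card ≤ 1) :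
    (cut G (X ∪ A) \ R).card ≤ (cut G X \ R).card + ∑ v ∈ A \ X, degIn R v := by
  have hnew : (cut G (X ∪ A) \ R) \ (cut G X \ R) ⊆ cut G A \ R := by
    rintro ⟨e, he⟩ h
    induction e using Sym2.ind with
    | _ a b =>
      simp only [mem_sdiff, mem_cut_mk, mem_union] at h ⊢
      tauto
  have hnew1 := (card_le_card hnew).trans hA
  have hle := card_le_card_sdiff_add_card (s := cut G (X ∪ A) \ R) (t := cut G X \ R)
  by_cases hsum : 1 ≤ ∑ v ∈ A \ X, degIn R v
  · omega
  have hdeg : ∀ v ∈ A \ X, ∀ e ∈ R, v ∉ (e : Sym2 V) := by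
    intro v hv e he hve
    have h0 : degIn R v = 0 := by
      have := single_le_sum (f := degIn R) (fun _ _ => Nat.zero_le _) hv
      omega
    rw [degIn, card_eq_zero] at h0
    exact notMem_empty e (h0 ▸ mem_filter.2 ⟨he, hve⟩)
  -- No edge of `R` touches `A \ X` from here on. If an edge `e₀` is new in the boundary, an old one
  -- has to be lost in exchange.
  refine le_trans ?_ (Nat.le_add_right _ _)
  rcases ((cut G (X ∪ A) \ R) \ (cut G X \ R)).eq_empty_or_nonempty with hempty | ⟨e₀, he₀⟩
  · exact card_le_card (sdiff_eq_empty_iff_subset.1 hempty)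
  refine card_le_of_sdiff (hnew1.trans (card_pos.2 ?_))
  have hB : (A \ X).Nonempty := by
    by_contra h
    rw [not_nonempty_iff_eq_empty, sdiff_eq_empty_iff_subset] at h
    rw [union_eq_left.2 h, sdiff_self] at he₀
    exact notMem_empty _ he₀
  -- A non-empty cut of even size has a second edge besides `e₀`. It is not in `R` and not new, so
  -- it joins `A \ X` to `X`, and the union with `A` removes it from the boundary.
  have h2 : 1 < (cut G (A \ X)).card := by
    have := card_pos.2 (hne hB)
    obtain ⟨r, hr⟩ := heven
    omega
  obtain ⟨⟨e, he⟩, heB, hee⟩ := exists_mem_ne h2 e₀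
  have hnot : (⟨e, he⟩ : G.edgeSet) ∉ (cut G (X ∪ A) \ R) \ (cut G X \ R) := fun h =>
    hee (card_le_one.1 hnew1 _ h _ he₀)
  refine ⟨⟨e, he⟩, ?_⟩
  induction e using Sym2.ind with
  | _ a b =>
    have ha : a ∈ A \ X → (⟨s(a, b), he⟩ : G.edgeSet) ∉ R := fun h hR =>
      hdeg a h _ hR (Sym2.mem_mk_left a b)
    have hb : b ∈ A \ X → (⟨s(a, b), he⟩ : G.edgeSet) ∉ R := fun h hR =>
      hdeg b h _ hR (Sym2.mem_mk_right a b)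
    simp only [mem_sdiff, mem_cut_mk, mem_union] at heB hnot ha hb ⊢
    generalize ((⟨s(a, b), he⟩ : G.edgeSet) ∈ R) = r at ha hb hnot ⊢
    grind

/-- All small vertex sets with at most one boundary edge outside `R` lie in one vertex set whose
size is linear in that of `R`. -/
theorem exists_cover_of_cut_le_one {c : ℝ} (hc : 0 < c) (hG : HasEdgeExpansion G c) {d : ℕ}
    (hd : G.IsRegularOfDegree d) (hd2 : Even d) (R : Finset G.edgeSet)
    (hR : 2 * (4 * (R.card : ℝ) + 1) ≤ c * Fintype.card V) :
    ∃ X : Finset V, c * X.card ≤ 3 * R.card ∧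
      ∀ A : Finset V, 2 * A.card ≤ Fintype.card V → (cut G A \ R).card ≤ 1 → A ⊆ X := by
  have hexp : ∀ A : Finset V, 2 * A.card ≤ Fintype.card V → c * A.card ≤ (cut G A).card := by
    intro A hA
    rw [← hammingNorm_bd_ind]
    have := le_hammingNorm_bd hG (ind A) (by rwa [hammingNorm_ind])
    rwa [hammingNorm_ind] at this
  have hcutR : ∀ A : Finset V, (cut G A).card ≤ (cut G A \ R).card + R.card := fun A =>
    card_le_card_sdiff_add_card (s := cut G A) (t := R)
  -- The invariant bounds the boundary outside `R` by `2 * R.card`, hence the whole boundary by `3 *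
  -- R.card`; it survives adding any admissible `A`, so a largest `X` contains all of them.
  obtain ⟨X, hX, hmax⟩ := exists_max_image
    (univ.filter fun X : Finset V => 2 * X.card ≤ Fintype.card V ∧
      (cut G X \ R).card ≤ ∑ v ∈ X, degIn R v) card
    ⟨∅, by simp [cut, show ind (∅ : Finset V) = 0 from rfl, bd_zero]⟩
  simp only [mem_filter, mem_univ, true_and] at hX hmax
  have hXc : c * X.card ≤ 3 * R.card := by
    refine (hexp X hX.1).trans ?_
    have := hcutR X
    have := sum_degIn_le R X
    exact_mod_cast (by omega : (cut G X).card ≤ 3 * R.card)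
  refine ⟨X, hXc, fun A hA hA1 => ?_⟩
  have hAc : c * A.card ≤ R.card + 1 := by
    refine (hexp A hA).trans ?_
    have := hcutR A
    exact_mod_cast (by omega : (cut G A).card ≤ R.card + 1)
  -- Here `4 * R.card + 1` is the sum of the bounds `3 * R.card` for `X` and `R.card + 1` for `A`.
  have hunion : 2 * (X ∪ A).card ≤ Fintype.card V := by
    have h1 : ((X ∪ A).card : ℝ) ≤ X.card + A.card := by exact_mod_cast card_union_le X A
    have h2 : c * (2 * (X ∪ A).card) ≤ c * Fintype.card V := by
      have := mul_le_mul_of_nonneg_left h1 hc.le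
      linarith
    exact_mod_cast le_of_mul_le_mul_left h2 hc
  have hBsmall : 2 * (A \ X).card ≤ Fintype.card V := by
    have := card_le_card (sdiff_subset : A \ X ⊆ A)
    omega
  have hle := card_cut_union_le (R := R) (X := X) (A := A) (even_card_cut hd hd2 _)
    (fun hB => by
      have h1 := hexp _ hBsmall
      have h2 : (0 : ℝ) < (A \ X).card := by exact_mod_cast card_pos.2 hB
      rw [← card_pos]
      exact_mod_cast (mul_pos hc h2).trans_le h1) hA1
  have hsum : ∑ v ∈ X ∪ A, degIn R v = ∑ v ∈ X, degIn R v + ∑ v ∈ A \ X, degIn R v := by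
    rw [← union_sdiff_self_eq_union, sum_union disjoint_sdiff]
  have hcard := hmax (X ∪ A) ⟨hunion, by omega⟩
  exact union_eq_left.1 (eq_of_subset_of_card_le subset_union_left hcard).symm

end Expansion

/-! ### Consistent restrictions, forced edges and the greedy killing of wide monomials -/

section Greedy

/-- The monomial `m` contains a literal at `e` that is set to zero by the value `b`. -/
def Falsifies {σ : Type*} (e : σ) (b : ZMod 2) (m : σ ⊕ σ →₀ ℕ) : Prop :=
  (b = 0 ∧ m (Sum.inl e) ≠ 0) ∨ (b = 1 ∧ m (Sum.inr e) ≠ 0)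

/-- If all monomials in `Φ` have many variables outside `C`, then some value of a variable outside
`C` falsifies a fixed proportion of them. -/
theorem exists_popular_literal {σ : Type*} [Fintype σ] [DecidableEq σ] (C : Finset σ)
    (Φ : Finset (σ ⊕ σ →₀ ℕ)) (hΦ : Φ.Nonempty) {k : ℕ} {β : ℝ} (hβ : 0 < β)
    (hk : 2 * Fintype.card σ * β ≤ k) (hw : ∀ m ∈ Φ, k < (width m \ C).card) :
    ∃ e ∉ C, ∃ b : ZMod 2, ∃ Ψ ⊆ Φ, (∀ m ∈ Ψ, Falsifies e b m) ∧ β * Φ.card ≤ Ψ.card := by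
  classical
  set good : σ × ZMod 2 → (σ ⊕ σ →₀ ℕ) → Prop := fun p m => p.1 ∉ C ∧ Falsifies p.1 p.2 m
    with hgood
  -- One falsifying literal is counted per variable, the positive one if both occur. Averaging over
  -- the `2 * Fintype.card σ` literals follows.
  have hcount : ∀ m ∈ Φ, k ≤ (univ.filter fun p => good p m).card := by
    intro m hm
    refine (hw m hm).le.trans (card_le_card_of_injOn
      (fun e => (e, if m (Sum.inl e) ≠ 0 then 0 else 1)) (fun e he => ?_) ?_)
    · obtain ⟨he1, he2⟩ := mem_sdiff.1 (mem_coe.1 he)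
      have he1 := (mem_filter.1 he1).2
      simp only [coe_filter, mem_univ, true_and, Set.mem_ofPred_eq, hgood, Falsifies]
      refine ⟨he2, ?_⟩
      by_cases h : m (Sum.inl e) = 0
      · simpa [h] using he1
      · simp [h]
    · intro e _ e' _ h
      exact congrArg Prod.fst h
  obtain ⟨m₀, hm₀⟩ := hΦ
  obtain ⟨e₀, -⟩ := card_pos.1 ((Nat.zero_le k).trans_lt (hw m₀ hm₀))
  have hsum : ∑ _p : σ × ZMod 2, β * Φ.card
      ≤ ∑ p : σ × ZMod 2, ((Φ.filter fun m => good p m).card : ℝ) := by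
    have h1 : ∑ p : σ × ZMod 2, (Φ.filter fun m => good p m).card
        = ∑ m ∈ Φ, (univ.filter fun p => good p m).card := by
      simp only [card_filter]
      exact sum_comm
    have h2 : Φ.card * k ≤ ∑ m ∈ Φ, (univ.filter fun p => good p m).card := by
      simpa using card_nsmul_le_sum _ _ _ hcount
    rw [← h1] at h2
    have h3 : ((Φ.card * k : ℕ) : ℝ)
        ≤ ∑ p : σ × ZMod 2, ((Φ.filter fun m => good p m).card : ℝ) := by exact_mod_cast h2
    refine le_trans ?_ h3
    rw [sum_const, card_univ, Fintype.card_prod, ZMod.card, nsmul_eq_mul]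
    push_cast
    have := mul_le_mul_of_nonneg_left hk (Nat.cast_nonneg (α := ℝ) Φ.card)
    linarith
  obtain ⟨⟨e, b⟩, -, hp⟩ := exists_le_of_sum_le ⟨(e₀, 0), mem_univ _⟩ hsum
  have hpos : 0 < (Φ.filter fun m => good (e, b) m).card := by
    have : (0 : ℝ) < Φ.card := by exact_mod_cast card_pos.2 ⟨m₀, hm₀⟩
    exact_mod_cast (mul_pos hβ this).trans_le hp
  obtain ⟨m, hm⟩ := card_pos.1 hpos
  exact ⟨e, (mem_filter.1 hm).2.1, b, _, filter_subset _ _,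
    fun m hm => (mem_filter.1 hm).2.2, hp⟩

variable {V : Type*} [Fintype V] [DecidableEq V] {G : SimpleGraph V}

/-- The restriction `ρ` of `R` satisfies every parity condition that follows from the constraints
at the vertices in a small set. -/
def Consistent (R : Finset G.edgeSet) (ρ : G.edgeSet → ZMod 2) : Prop :=
  ∀ A : V → ZMod 2, 2 * hammingNorm A ≤ Fintype.card V → coreBd G R A = 0 → charge G R ρ A = 0

/-- The restriction of `R` forces the value of the edge `e`. -/
def Forced (R : Finset G.edgeSet) (e : G.edgeSet) : Prop :=
  ∃ A : V → ZMod 2, 2 * hammingNorm A ≤ Fintype.card V ∧ bd G A e ≠ 0 ∧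
    coreBd G (insert e R) A = 0

theorem coreBd_eq_zero_iff {R : Finset G.edgeSet} {A : V → ZMod 2} :
    coreBd G R A = 0 ↔ ∀ e ∉ R, bd G A e = 0 := by
  constructor
  · intro h e he
    simpa [coreBd, he] using congrFun h e
  · intro h
    funext e
    by_cases he : e ∈ R <;> simp [coreBd, he, h]

theorem coreBd_eq_zero_of_insert {R : Finset G.edgeSet} {e : G.edgeSet} {A : V → ZMod 2}
    (h : coreBd G (insert e R) A = 0) (he : bd G A e = 0) : coreBd G R A = 0 := by
  rw [coreBd_eq_zero_iff] at h ⊢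
  intro e' he'
  by_cases hee : e' = e
  · rw [hee, he]
  · exact h e' (by simp [hee, he'])

theorem Forced.insert {R : Finset G.edgeSet} {e e' : G.edgeSet} (h : Forced R e') :
    Forced (insert e R) e' := by
  obtain ⟨A, h1, h2, h3⟩ := h
  refine ⟨A, h1, h2, ?_⟩
  rw [coreBd_eq_zero_iff] at h3 ⊢
  exact fun e₁ he₁ => h3 e₁ fun h => he₁ (by grind)

theorem charge_insert_update {R : Finset G.edgeSet} {e : G.edgeSet} (he : e ∉ R)
    (ρ : G.edgeSet → ZMod 2) (b : ZMod 2) (A : V → ZMod 2) :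
    charge G (insert e R) (Function.update ρ e b) A = charge G R ρ A + bd G A e * b := by
  have h : ∑ e' ∈ R, bd G A e' * Function.update ρ e b e' = ∑ e' ∈ R, bd G A e' * ρ e' := by
    refine sum_congr rfl fun e' he' => ?_
    rw [Function.update_of_ne (by rintro rfl; exact he he')]
  rw [charge, charge, sum_insert he, h, Function.update_self]
  ring

/-- If `e` is not forced, no small set has a boundary in `insert e R` that contains `e`, so no new
condition arises and both values are allowed. -/
theorem Consistent.insert_of_not_forced {R : Finset G.edgeSet} {ρ : G.edgeSet → ZMod 2}
    (h : Consistent R ρ) {e : G.edgeSet} (he : e ∉ R) (hf : ¬ Forced R e) (b : ZMod 2) :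
    Consistent (insert e R) (Function.update ρ e b) := by
  intro A hA hcore
  have hAe : bd G A e = 0 := by
    by_contra hne
    exact hf ⟨A, hA, hne, hcore⟩
  rw [charge_insert_update he, hAe, zero_mul, add_zero]
  exact h A hA (coreBd_eq_zero_of_insert hcore hAe)

variable [DecidableRel G.Adj]

theorem hammingNorm_bd_le (R : Finset G.edgeSet) (A : V → ZMod 2) :
    hammingNorm (bd G A) ≤ hammingNorm (coreBd G R A) + R.card := by
  refine le_trans (card_le_card fun e he => ?_) (card_union_le _ _)
  rw [mem_union, mem_filter]
  by_cases hR : e ∈ R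
  · exact Or.inr hR
  · exact Or.inl ⟨mem_univ _, by simpa [coreBd, hR] using he⟩

/-- Expansion bounds a set whose boundary lies in `R` by `R.card / c`, at most a quarter of the
vertices, so two of them together stay within half. -/
theorem two_mul_hammingNorm_add_le {c : ℝ} (hc : 0 < c) (hG : HasEdgeExpansion G c)
    {R : Finset G.edgeSet} (hR : 4 * (R.card : ℝ) ≤ c * Fintype.card V) {A B : V → ZMod 2}
    (hA : 2 * hammingNorm A ≤ Fintype.card V) (hB : 2 * hammingNorm B ≤ Fintype.card V)
    (hA0 : coreBd G R A = 0) (hB0 : coreBd G R B = 0) :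
    2 * hammingNorm (A + B) ≤ Fintype.card V := by
  have key : ∀ D, 2 * hammingNorm D ≤ Fintype.card V → coreBd G R D = 0 →
      c * hammingNorm D ≤ R.card := by
    intro D hD hD0
    refine (le_hammingNorm_bd hG D hD).trans ?_
    have := hammingNorm_bd_le R D
    rw [hD0, hammingNorm_zero, zero_add] at this
    exact_mod_cast this
  have h1 := key A hA hA0
  have h2 := key B hB hB0
  have h3 : (hammingNorm (A + B) : ℝ) ≤ hammingNorm A + hammingNorm B := by
    exact_mod_cast hammingNorm_add_le A B
  have h4 : c * (2 * hammingNorm (A + B)) ≤ c * Fintype.card V := by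
    have := mul_le_mul_of_nonneg_left h3 hc.le
    linarith
  exact_mod_cast le_of_mul_le_mul_left h4 hc

theorem Consistent.exists_insert {c : ℝ} (hc : 0 < c) (hG : HasEdgeExpansion G c)
    {R : Finset G.edgeSet} {ρ : G.edgeSet → ZMod 2} (h : Consistent R ρ) {e : G.edgeSet}
    (he : e ∉ R) (hR : 4 * ((insert e R).card : ℝ) ≤ c * Fintype.card V) :
    ∃ b, Consistent (insert e R) (Function.update ρ e b) := by
  by_cases hf : Forced R e
  · obtain ⟨B, hB, hBe, hB0⟩ := hf
    -- The witness `B` dictates the value of `e`. Any other witness `A` agrees, because `e` cancels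
    -- in the boundary of the small set `A + B`, to which the consistency of `ρ` applies.
    refine ⟨charge G R ρ B, fun A hA hcore => ?_⟩
    rw [charge_insert_update he]
    rcases zmod_two_cases (bd G A e) with hAe | hAe
    · rw [hAe, zero_mul, add_zero]
      exact h A hA (coreBd_eq_zero_of_insert hcore hAe)
    · rw [hAe, one_mul, ← charge_add]
      refine h _ (two_mul_hammingNorm_add_le hc hG hR hA hB hcore hB0)
        (coreBd_eq_zero_of_insert (e := e) (by rw [coreBd_add, hcore, hB0, add_zero]) ?_)
      rw [bd_add, Pi.add_apply, hAe, (zmod_two_cases _).resolve_left hBe]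
      exact CharTwo.add_self_eq_zero _
  · exact ⟨0, h.insert_of_not_forced he hf 0⟩

/-- Keeping the values on `R` matters because monomials killed by `ρ` then stay killed. -/
theorem Consistent.exists_union {c : ℝ} (hc : 0 < c) (hG : HasEdgeExpansion G c)
    {R : Finset G.edgeSet} {ρ : G.edgeSet → ZMod 2} (h : Consistent R ρ) (F : Finset G.edgeSet)
    (hR : 4 * ((F ∪ R).card : ℝ) ≤ c * Fintype.card V) :
    ∃ ρ', Consistent (F ∪ R) ρ' ∧ ∀ e ∈ R, ρ' e = ρ e := by
  induction F using Finset.induction_on with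
  | empty => exact ⟨ρ, by rwa [empty_union], fun _ _ => rfl⟩
  | insert e F _ ih =>
    rw [insert_union] at hR ⊢
    have hle : ((F ∪ R).card : ℝ) ≤ (insert e (F ∪ R)).card := by
      exact_mod_cast card_le_card (subset_insert _ _)
    obtain ⟨ρ', h', hρ'⟩ := ih (by linarith)
    by_cases he : e ∈ F ∪ R
    · exact ⟨ρ', by rwa [insert_eq_of_mem he], hρ'⟩
    · obtain ⟨b, hb⟩ := h'.exists_insert hc hG he hR
      refine ⟨_, hb, fun e' he' => ?_⟩
      rw [Function.update_of_ne, hρ' e' he']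
      rintro rfl
      exact he (mem_union_right _ he')

open Classical in
/-- The edges that are restricted or whose value is forced. -/
noncomputable def closure (R : Finset G.edgeSet) : Finset G.edgeSet :=
  univ.filter fun e => e ∈ R ∨ Forced R e

theorem mem_closure {R : Finset G.edgeSet} {e : G.edgeSet} :
    e ∈ closure R ↔ e ∈ R ∨ Forced R e := by
  simp [closure]

theorem closure_subset_insert (R : Finset G.edgeSet) (e : G.edgeSet) :
    closure R ⊆ closure (insert e R) := by
  intro e' he'
  rw [mem_closure] at he' ⊢
  rcases he' with h | h
  · exact Or.inl (mem_insert_of_mem h)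
  · exact Or.inr h.insert

/-- The monomial `m` is not killed by the restriction and has more than `k` free variables. -/
def Fat (k : ℕ) (R : Finset G.edgeSet) (ρ : G.edgeSet → ZMod 2)
    (m : G.edgeSet ⊕ G.edgeSet →₀ ℕ) : Prop :=
  ¬ Killed R ρ m ∧ k < (width m \ closure R).card

theorem Fat.of_insert {k : ℕ} {R : Finset G.edgeSet} {ρ : G.edgeSet → ZMod 2} {e : G.edgeSet}
    {b : ZMod 2} (he : e ∉ R) {m : G.edgeSet ⊕ G.edgeSet →₀ ℕ}
    (h : Fat k (insert e R) (Function.update ρ e b) m) : Fat k R ρ m ∧ ¬ Falsifies e b m := by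
  refine ⟨⟨fun hk => h.1 ?_, h.2.trans_le
    (card_le_card (sdiff_subset_sdiff le_rfl (closure_subset_insert R e)))⟩, fun hf => h.1 ?_⟩
  · obtain ⟨e', he', hk⟩ := hk
    refine ⟨e', mem_insert_of_mem he', ?_⟩
    rwa [Function.update_of_ne (by rintro rfl; exact he he')]
  · refine ⟨e, mem_insert_self _ _, ?_⟩
    rwa [Function.update_self]

open Classical in
/-- A consistent restriction of `q` edges that leaves only an exponentially small proportion of
the wide monomials. -/
theorem exists_restriction {c : ℝ} (hc : 0 < c) (hG : HasEdgeExpansion G c)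
    (M : Finset (G.edgeSet ⊕ G.edgeSet →₀ ℕ)) {k : ℕ} {β : ℝ} (hβ : 0 < β)
    (hk : 2 * Fintype.card G.edgeSet * β ≤ k) (q : ℕ) :
    ∃ (R : Finset G.edgeSet) (ρ : G.edgeSet → ZMod 2), R.card ≤ q ∧ Consistent R ρ ∧
      ((M.filter (Fat k R ρ)).card : ℝ) ≤ Real.exp (-(β * q)) * M.card := by
  induction q with
  | zero =>
    refine ⟨∅, 0, le_rfl, fun A hA hcore => ?_, ?_⟩
    · rw [eq_zero_of_bd_eq_zero hc hG hA
        (funext fun e => coreBd_eq_zero_iff.1 hcore e (notMem_empty e)), charge_zero]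
    · simpa using card_filter_le M _
  | succ q ih =>
    obtain ⟨R, ρ, hRq, hcons, hle⟩ := ih
    rcases (M.filter (Fat k R ρ)).eq_empty_or_nonempty with hΦ | hΦ
    · refine ⟨R, ρ, hRq.trans (Nat.le_succ q), hcons, ?_⟩
      rw [hΦ, card_empty, Nat.cast_zero]
      positivity
    -- The popular literal lies outside the closure, so its edge is not forced and may take the
    -- falsifying value.
    obtain ⟨e, heC, b, Ψ, hΨ, hfals, hcard⟩ := exists_popular_literal (closure R) _ hΦ hβ hk
      fun m hm => (mem_filter.1 hm).2.2
    rw [mem_closure] at heC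
    push Not at heC
    refine ⟨insert e R, Function.update ρ e b, (card_insert_le _ _).trans (by omega),
      hcons.insert_of_not_forced heC.1 heC.2 b, ?_⟩
    have hsub : M.filter (Fat k (insert e R) (Function.update ρ e b))
        ⊆ M.filter (Fat k R ρ) \ Ψ := by
      intro m hm
      rw [mem_filter] at hm
      obtain ⟨h1, h2⟩ := hm.2.of_insert heC.1
      exact mem_sdiff.2 ⟨mem_filter.2 ⟨hm.1, h1⟩, fun h => h2 (hfals m h)⟩
    have h1 : ((M.filter (Fat k (insert e R) (Function.update ρ e b))).card : ℝ) + Ψ.card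
        ≤ (M.filter (Fat k R ρ)).card := by
      have h := card_le_card hsub
      have h' := card_sdiff_add_card_eq_card hΨ
      exact_mod_cast (by omega : (M.filter (Fat k (insert e R) (Function.update ρ e b))).card
        + Ψ.card ≤ (M.filter (Fat k R ρ)).card)
    have h2 : 1 - β ≤ Real.exp (-β) := Real.one_sub_le_exp_neg β
    calc ((M.filter (Fat k (insert e R) (Function.update ρ e b))).card : ℝ)
        ≤ (1 - β) * (M.filter (Fat k R ρ)).card := by linarith
      _ ≤ Real.exp (-β) * (M.filter (Fat k R ρ)).card :=
          mul_le_mul_of_nonneg_right h2 (Nat.cast_nonneg _)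
      _ ≤ Real.exp (-β) * (Real.exp (-(β * q)) * M.card) :=
          mul_le_mul_of_nonneg_left hle (Real.exp_nonneg _)
      _ = Real.exp (-(β * (q + 1 : ℕ))) * M.card := by
          rw [← mul_assoc, ← Real.exp_add]
          push_cast
          ring_nf

/-- The forced edges of a small restriction are covered by few edges. -/
theorem exists_closure_cover {c : ℝ} (hc : 0 < c) (hG : HasEdgeExpansion G c) {d : ℕ}
    (hd : G.IsRegularOfDegree d) (hd2 : Even d) (R : Finset G.edgeSet)
    (hR : 2 * (4 * (R.card : ℝ) + 1) ≤ c * Fintype.card V) :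
    ∃ F : Finset G.edgeSet, closure R ⊆ F ∪ R ∧ c * F.card ≤ 3 * d * R.card := by
  obtain ⟨X, hX, hcover⟩ := exists_cover_of_cut_le_one hc hG hd hd2 R hR
  refine ⟨X.biUnion fun v => univ.filter fun e : G.edgeSet => v ∈ (e : Sym2 V), ?_, ?_⟩
  · intro e he
    rcases mem_closure.1 he with h | ⟨A, hA, hAe, hcore⟩
    · exact mem_union_right _ h
    refine mem_union_left _ ?_
    have hsub := hcover (univ.filter fun v => A v ≠ 0) hA (by
      refine card_le_one.2 ?_
      have : ∀ e' ∈ cut G (univ.filter fun v => A v ≠ 0) \ R, e' = e := by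
        intro e' he'
        rw [mem_sdiff, cut, mem_filter, ind_support] at he'
        by_contra hne
        exact he'.1.2 (coreBd_eq_zero_iff.1 hcore e' (by simp [hne, he'.2]))
      intro e₁ h₁ e₂ h₂
      rw [this e₁ h₁, this e₂ h₂])
    obtain ⟨v, hv, hAv⟩ := exists_ne_zero_of_sum_ne_zero hAe
    exact mem_biUnion.2 ⟨v, hsub (mem_filter.2 ⟨mem_univ _, hAv⟩),
      mem_filter.2 ⟨mem_univ _, (mem_filter.1 hv).2⟩⟩
  · have h1 : (X.biUnion fun v => univ.filter fun e : G.edgeSet => v ∈ (e : Sym2 V)).card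
        ≤ X.card * d := by
      refine card_biUnion_le_card_mul _ _ _ fun v _ => ?_
      rw [card_edges_eq (p := fun e => v ∈ e), ← G.incidenceFinset_eq_filter,
        G.card_incidenceFinset_eq_degree, hd.degree_eq]
    have h2 : ((X.biUnion fun v => univ.filter fun e : G.edgeSet => v ∈ (e : Sym2 V)).card : ℝ)
        ≤ X.card * d := by exact_mod_cast h1
    have h3 := mul_le_mul_of_nonneg_left h2 hc.le
    have h4 := mul_le_mul_of_nonneg_right hX (Nat.cast_nonneg (α := ℝ) d)
    linarith

/-- The monomials that occur in the polynomials of a refutation. -/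
noncomputable def monomials (Q : TseitinRefutation G) : Finset (G.edgeSet ⊕ G.edgeSet →₀ ℕ) :=
  (Q.r₀.toFinset.biUnion fun r => r.support) ∪ univ.biUnion fun u => (Q.t u).support

theorem card_monomials_le (Q : TseitinRefutation G) : (monomials Q).card ≤ Q.monomialSize := by
  classical
  have h1 : (Q.r₀.toFinset.biUnion fun r => r.support).card ≤ TwinPoly.listSize Q.r₀ := by
    generalize Q.r₀ = l
    induction l with
    | nil => simp
    | cons a l ih =>
      rw [List.toFinset_cons, biUnion_insert]
      exact (card_union_le _ _).trans (Nat.add_le_add_left ih _)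
  have h2 : (univ.biUnion fun u => (Q.t u).support).card ≤ ∑ u, TwinPoly.size (Q.t u) :=
    card_biUnion_le
  rw [SOSProof.monomialSize, univ_eq_empty, sum_empty, add_zero]
  exact (card_union_le _ _).trans (add_le_add h1 h2)

/-- Every refutation of the Tseitin formula of an expander of even degree has at least
`exp (β * q)` monomials, if `q` is small enough for restrictions of `q` edges. -/
theorem exp_le_card_monomials {c : ℝ} (hc : 0 < c) (hG : HasEdgeExpansion G c) {d : ℕ}
    (hd : G.IsRegularOfDegree d) (hd2 : Even d) {k q : ℕ} {β : ℝ} (hβ : 0 < β)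
    (hk : 2 * Fintype.card G.edgeSet * β ≤ k) (hdk : d ≤ k) (hV : 3 ≤ Fintype.card V)
    (hq : 2 * (4 * (q : ℝ) + 1) ≤ c * Fintype.card V)
    (hkq : 6 * (2 * k + (q + 3 * d * q / c)) ≤ c * Fintype.card V)
    (Q : TseitinRefutation G) : Real.exp (β * q) ≤ (monomials Q).card := by
  classical
  by_contra hlt
  push Not at hlt
  obtain ⟨R, ρ, hRq, hcons, hfat⟩ := exists_restriction hc hG (monomials Q) hβ hk q
  have hRq' : (R.card : ℝ) ≤ q := by exact_mod_cast hRq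
  have hnofat : ∀ m ∈ monomials Q, ¬ Fat k R ρ m := by
    have h1 : (((monomials Q).filter (Fat k R ρ)).card : ℝ) < 1 := by
      refine hfat.trans_lt ?_
      rw [Real.exp_neg, inv_mul_lt_iff₀ (Real.exp_pos _), mul_one]
      exact hlt
    have h2 : ((monomials Q).filter (Fat k R ρ)).card = 0 := by
      exact_mod_cast Nat.lt_one_iff.1 (by exact_mod_cast h1)
    exact filter_eq_empty_iff.1 (card_eq_zero.1 h2)
  obtain ⟨F, hF, hFc⟩ := exists_closure_cover hc hG hd hd2 R (by linarith)
  have hFR : 6 * (2 * (k : ℝ) + (F ∪ R).card) ≤ c * Fintype.card V := by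
    have h1 : ((F ∪ R).card : ℝ) ≤ F.card + R.card := by exact_mod_cast card_union_le F R
    have h2 : (F.card : ℝ) ≤ 3 * d * q / c := by
      rw [le_div_iff₀ hc]
      have := mul_le_mul_of_nonneg_left hRq' (by positivity : (0 : ℝ) ≤ 3 * d)
      linarith
    linarith
  have hk0 : (0 : ℝ) ≤ k := Nat.cast_nonneg k
  have hFR0 : (0 : ℝ) ≤ (F ∪ R).card := Nat.cast_nonneg _
  obtain ⟨ρ', hcons', hρ'⟩ := hcons.exists_union hc hG F (by linarith)
  have hlow : ∀ m ∈ monomials Q,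
      Killed (F ∪ R) ρ' m ∨ (width m \ (F ∪ R)).card ≤ k := by
    intro m hm
    by_cases hkill : Killed R ρ m
    · obtain ⟨e, he, h⟩ := hkill
      exact Or.inl ⟨e, mem_union_right _ he, by rwa [hρ' e he]⟩
    · have h1 : (width m \ closure R).card ≤ k := by
        by_contra h
        exact hnofat m hm ⟨hkill, not_le.1 h⟩
      exact Or.inr ((card_le_card (sdiff_subset_sdiff le_rfl hF)).trans h1)
  -- The gap: a set with at most `n/2` vertices and a boundary of at most `2 * k` edges outside `F ∪
  -- R` has at most `n/6` vertices.
  have hsmall : ∀ A : V → ZMod 2, 2 * hammingNorm A ≤ Fintype.card V →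
      hammingNorm (coreBd G (F ∪ R) A) ≤ 2 * k → 6 * hammingNorm A ≤ Fintype.card V := by
    intro A hA hAk
    have h1 := le_hammingNorm_bd hG A hA
    have h2 := hammingNorm_bd_le (F ∪ R) A
    have h3 : (hammingNorm (bd G A) : ℝ) ≤ 2 * k + (F ∪ R).card := by
      exact_mod_cast (by omega : hammingNorm (bd G A) ≤ 2 * k + (F ∪ R).card)
    have h4 : c * (6 * hammingNorm A) ≤ c * Fintype.card V := by linarith
    exact_mod_cast le_of_mul_le_mul_left h4 hc
  -- Sums of two sets of size at most `n/6`, or of one such set and a vertex (as `n ≥ 3`), stay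
  -- within `n/2`, where consistency and `hsmall` apply.
  refine no_low_width_refutation (F ∪ R) ρ' k (fun A => 6 * hammingNorm A ≤ Fintype.card V)
    (by simp) ?_ ?_ ?_ (fun u => ?_) Q
    (fun r hr m hm => hlow m (mem_union_left _ (mem_biUnion.2 ⟨r, List.mem_toFinset.2 hr, hm⟩)))
    (fun u m hm => hlow m (mem_union_right _ (mem_biUnion.2 ⟨u, mem_univ _, hm⟩)))
  · intro A B hA hB h
    have := hammingNorm_add_le A B
    exact hcons' _ (by omega) h
  · intro A B hA hB h
    have := hammingNorm_add_le A B
    exact hsmall _ (by omega) h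
  · intro A u hA h
    have h1 := hammingNorm_add_le A (Pi.single u 1)
    have h2 : hammingNorm (Pi.single u 1 : V → ZMod 2) ≤ 1 := by
      refine card_le_one.2 fun v hv w hw => ?_
      have : ∀ x ∈ univ.filter (fun x => (Pi.single u 1 : V → ZMod 2) x ≠ 0), x = u := by
        intro x hx
        by_contra hne
        exact (mem_filter.1 hx).2 (Pi.single_eq_of_ne hne _)
      rw [this v hv, this w hw]
    exact hsmall _ (by omega) h
  · rw [hammingNorm_bd_single, hd.degree_eq]
    exact hdk

end Greedy

end TseitinSOS

/-! ### Choice of the constants -/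

theorem mainTheorem6 (S : Set ℕ) (G : (n : ℕ) → SimpleGraph (Fin n))
    [∀ n, DecidableRel (G n).Adj] (d : ℕ) (hG : IsRegularExpanderFamily S G d) :
    ∃ ε : ℝ, 0 < ε ∧ ∃ N : ℕ, ∀ n ∈ S, N ≤ n →
      ∀ P : TseitinRefutation (G n), (2 : ℝ) ^ (ε * (n : ℝ)) ≤ (P.monomialSize : ℝ) := by
  obtain ⟨hreg, c, hc, hexp⟩ := hG
  have hd0 : (0 : ℝ) ≤ d := Nat.cast_nonneg d
  -- With `q ≤ γ * n`, the restricted edges and the cover of the forced ones number at most `c * n /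
  -- 12`. The choice of `β` gives `2 * |E| * β ≤ c * n / 48`, which is at most `k = ⌊c * n / 24⌋₊`
  -- for large `n`.
  set γ : ℝ := c ^ 2 / (12 * (c + 3 * d)) with hγ
  set β : ℝ := c / (48 * (d + 1)) with hβ
  have hγ0 : 0 < γ := by positivity
  have hβ0 : 0 < β := by positivity
  have hγc : γ * (1 + 3 * d / c) = c / 12 := by
    rw [hγ]
    field_simp
  -- In turn: `n ≥ 3` for adding a vertex; `c * n ≥ 6` for the size condition on `q`; `c * n ≥ 48 *
  -- (d + 1)` for `d ≤ k` and `c * n / 48 ≤ k`; `γ * n ≥ 2` for `q ≥ γ * n / 2`.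
  obtain ⟨N, hN⟩ := exists_nat_ge (max 3 (max (6 / c) (max (48 * (d + 1) / c) (2 / γ))))
  simp only [max_le_iff] at hN
  obtain ⟨hN3, hNc, hNd, hNγ⟩ := hN
  refine ⟨β * γ / 2, by positivity, N, fun n hn hNn P => ?_⟩
  have hNn' : (N : ℝ) ≤ n := by exact_mod_cast hNn
  rcases Nat.even_or_odd n with heven | hodd
  · exact (TseitinSOS.no_refutation_of_even hc (hexp n hn) (by simpa using heven) P).elim
  have hedges := TseitinSOS.two_mul_card_edgeSet (hreg n hn)
  rw [Fintype.card_fin] at hedges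
  have hd2 : Even d := by
    have h : Even (n * d) := ⟨_, by rw [← hedges, two_mul]⟩
    exact (Nat.even_mul.1 h).resolve_left (Nat.not_even_iff_odd.2 hodd)
  have h6 : 6 ≤ c * n := by
    have := (div_le_iff₀ hc).1 (hNc.trans hNn')
    linarith
  have h48 : 48 * ((d : ℝ) + 1) ≤ c * n := by
    have := (div_le_iff₀ hc).1 (hNd.trans hNn')
    linarith
  have h2 : 2 ≤ γ * n := by
    have := (div_le_iff₀ hγ0).1 (hNγ.trans hNn')
    linarith
  set k : ℕ := ⌊c * n / 24⌋₊ with hk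
  set q : ℕ := ⌊γ * n⌋₊ with hq
  have hk1 : (k : ℝ) ≤ c * n / 24 := Nat.floor_le (by positivity)
  have hk2 : c * n / 24 < k + 1 := Nat.lt_floor_add_one _
  have hq1 : (q : ℝ) ≤ γ * n := Nat.floor_le (by positivity)
  have hq2 : γ * n < q + 1 := Nat.lt_floor_add_one _
  have hR : (q : ℝ) + 3 * d * q / c ≤ c * n / 12 := by
    calc (q : ℝ) + 3 * d * q / c = q * (1 + 3 * d / c) := by ring
      _ ≤ γ * n * (1 + 3 * d / c) := mul_le_mul_of_nonneg_right hq1 (by positivity)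
      _ = n * (γ * (1 + 3 * d / c)) := by ring
      _ = c * n / 12 := by rw [hγc]; ring
  have hR0 : (0 : ℝ) ≤ 3 * d * q / c := by positivity
  have hmain := TseitinSOS.exp_le_card_monomials hc (hexp n hn) (hreg n hn) hd2 (k := k) (q := q)
    hβ0
    (by
      have h1 : (2 : ℝ) * Fintype.card (G n).edgeSet = n * d := by exact_mod_cast hedges
      rw [h1]
      have h3 : (n : ℝ) * d * β ≤ c * n / 48 := by
        calc (n : ℝ) * d * β ≤ n * (d + 1) * β := by gcongr; linarith
          _ = c * n / 48 := by rw [hβ]; field_simp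
      linarith)
    (by
      have h1 : (d : ℝ) ≤ k := by linarith
      exact_mod_cast h1)
    (by
      rw [Fintype.card_fin]
      exact_mod_cast hN3.trans hNn')
    (by rw [Fintype.card_fin]; linarith) (by rw [Fintype.card_fin]; linarith) P
  have hsize : ((TseitinSOS.monomials P).card : ℝ) ≤ P.monomialSize := by
    exact_mod_cast TseitinSOS.card_monomials_le P
  refine le_trans ?_ (hmain.trans hsize)
  -- The half in `ε` pays for rounding `γ * n` down to `q`, and `log 2 ≤ 1` allows passing from base
  -- 2 to base `e`.
  rw [Real.rpow_def_of_pos two_pos, Real.exp_le_exp]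
  have hlog : Real.log 2 ≤ 1 := by linarith [Real.log_two_lt_d9]
  have hx : 0 ≤ β * γ / 2 * n := by positivity
  have h1 : Real.log 2 * (β * γ / 2 * n) ≤ β * γ / 2 * n := mul_le_of_le_one_left hx hlog
  have h3 : β * (γ * n / 2) ≤ β * q := mul_le_mul_of_nonneg_left (by linarith) hβ0.le
  linarith
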